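/- A server holds a library of $N$ files of $B$ bits each and is connected to its users by an error-free broadcast link. There are $\Lambda$ caches of size $MB$ bits. Every user has full access to a subset of the caches and requests one file. In the generalized combinatorial topology with parameters $(K_0,\dots,K_\Lambda)\in\mathbb{Z}_{\ge 0}^{\Lambda+1}$, every set $\mathcal U\subseteq[\Lambda]$ of $\lambda$ caches is connected, exactly and uniquely, to $K_\lambda$ users, for each $\lambda\in[0:\Lambda]$; it is assumed that $K=\sum_{\lambda}K_\lambda\binom{\Lambda}{\lambda}\le N$. An uncoded placement copies bits of the library into the caches, at most $MB$ bits into each, before the demands are known. It guarantees the worst-case load $R$ if, for each demand vector, there is a broadcast of at most $RB$ bits, an arbitrary function of the library, from which, together with the contents of the caches it is connected to, every user recovers its requested file, whatever the content of the library is. Let $R^\star_{\mathrm{comb}}(M)$ be the infimum of the loads $R$ that some uncoded placement, possibly depending on the topology, guarantees with cache size $MB$ for some file size $B\ge 1$. For $t\in[0:\Lambda]$, the basic $\Lambda$-cache MAN placement splits every file $W_n$ into $\binom{\Lambda}{t}$ equal-sized disjoint subfiles $W_{n,\mathcal T}$, $\mathcal T\subseteq[\Lambda]$, $|\mathcal T|=t$,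 and stores $W_{n,\mathcal T}$ in the caches $\ell\in\mathcal T$. Memory sharing between $t$ and $t+1$ cuts every file into two parts, of the same sizes for all files, and applies the basic MAN placement with parameter $t$ to the first parts and with parameter $t+1$ to the second parts (for $t=\Lambda$ the second parts are empty). These placements do not depend on $(K_0,\dots,K_\Lambda)$. Then: 1. For all $t\in[0:\Lambda]$ and all $B\geq 1$ for which it is defined, the basic MAN placement with parameter $t$ stores exactly $MB$ bits in every cache, with $M=tN/\Lambda$, and guarantees the optimal worst-case load $R^\star_{\mathrm{comb}}(M)$ for every generalized combinatorial topology with $K\le N$. 2. The MAN placement with memory sharing, in which the fractions $\alpha$ and $1-\alpha$ of each file are treated with the parameters $t$ and $t+1$, stores exactly $MB$ bits in every cache, with $M=(\alpha t+(1-\alpha)(t+1))N/\Lambda$, and guarantees the optimal worst-case load $R^\star_{\mathrm{comb}}(M)$ for every generalized combinatorial topology with $K\le N$. 3. For every real $M\ge 0$ and every $\varepsilon>0$ there is one MAN placement with memory sharing, storing at most $MB$ bits in every cache, that guarantees the worst-case load $R^\star_{\mathrm{comb}}(M)+\varepsilon$ for every generalized combinatorial topology with $K\le N$. (For $\Lambda=0$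 there are no caches; the quotient $N/\Lambda$ is then read as $0$.) -/

import Mathlib

namespace MACC

/-- A connectivity of `Λ` caches: `b U` is the number of users that are connected exactly to the
caches in the set `U` (and to no other cache). -/
abbrev Connectivity (Λ : ℕ) : Type := Finset (Fin Λ) → ℕ

/-- The users of a connectivity: `⟨U, k⟩` is the `k`-th user connected exactly to the caches
in `U`. -/
abbrev User {Λ : ℕ} (b : Connectivity Λ) : Type := Σ U : Finset (Fin Λ), Fin (b U)

/-- The generalized combinatorial topology with parameters `K 0, …, K Λ`: every set of `j` caches
is uniquely assigned to exactly `K j` users, for every `j`. -/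
def IsGeneralizedCombinatorial {Λ : ℕ} (b : Connectivity Λ) : Prop :=
  ∃ K : ℕ → ℕ, ∀ U : Finset (Fin Λ), b U = K U.card

/-- A library of `N` files of `B` bits each. -/
abbrev Library (N B : ℕ) : Type := Fin N → Fin B → Bool

/-- An uncoded placement: every cache holds plain copies of some bits of the library; `(n, i)` is
the `i`-th bit of the `n`-th file. -/
abbrev Placement (Λ N B : ℕ) : Type := Fin Λ → Finset (Fin N × Fin B)

/-- The library bits that a user connected to the caches in `U` has access to. -/
def accessible {Λ N B : ℕ} (P : Placement Λ N B) (U : Finset (Fin Λ)) : Finset (Fin N × Fin B) :=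
  U.biUnion P

/-- The contents of the caches in `U`, when the library is `W`. -/
def cacheContents {Λ N B : ℕ} (P : Placement Λ N B) (U : Finset (Fin Λ)) (W : Library N B) :
    {x // x ∈ accessible P U} → Bool :=
  fun x => W x.1.1 x.1.2

/-- For the placement `P` and the demand vector `d`, the demands of all users can be served by a
broadcast of `L` bits: the broadcast is an arbitrary function of the library, and every user
recovers its file, for every library, from the broadcast and from the caches it is connected to. -/
def Delivers {Λ N B : ℕ} (b : Connectivity Λ) (P : Placement Λ N B) (d : User b → Fin N)
    (L : ℕ) : Prop :=
  ∃ (encode : Library N B → (Fin L → Bool))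
    (decode : (u : User b) → (Fin L → Bool) → ({x // x ∈ accessible P u.1} → Bool) →
      (Fin B → Bool)),
    ∀ (W : Library N B) (u : User b),
      decode u (encode W) (cacheContents P u.1 W) = W (d u)

/-- With the placement `P`, the worst-case load `R` is guaranteed: whatever the demand, at most
`R * B` bits have to be broadcast. -/
def GuaranteesLoad {Λ N B : ℕ} (b : Connectivity Λ) (P : Placement Λ N B) (R : ℝ) : Prop :=
  ∀ d : User b → Fin N, ∃ L : ℕ, (L : ℝ) ≤ R * B ∧ Delivers b P d L

/-- Every cache holds at most `M * B` bits. -/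
def MeetsMemory {Λ N B : ℕ} (P : Placement Λ N B) (M : ℝ) : Prop :=
  ∀ ℓ : Fin Λ, ((P ℓ).card : ℝ) ≤ M * B

/-- The pair `(M, R)` is achievable under uncoded placement, for a library of `N` files: for some
file size there are an uncoded placement, which may depend on the connectivity `b`, and delivery
schemes that guarantee the worst-case load `R`. -/
def Achievable {Λ : ℕ} (b : Connectivity Λ) (N : ℕ) (M R : ℝ) : Prop :=
  ∃ B : ℕ, 0 < B ∧ ∃ P : Placement Λ N B, MeetsMemory P M ∧ GuaranteesLoad b P R

/-- The optimal worst-case load under uncoded placement. -/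
noncomputable def optimalLoad {Λ : ℕ} (b : Connectivity Λ) (N : ℕ) (M : ℝ) : ℝ :=
  sInf {R : ℝ | Achievable b N M R}

/-- A splitting of the files into subfiles labelled by sets of caches: `σ n i = T` says that the
`i`-th bit of the `n`-th file belongs to the subfile with label `T`. -/
abbrev Splitting (Λ N B : ℕ) : Type := Fin N → Fin B → Finset (Fin Λ)

/-- The number of bits of the subfile of the `n`-th file with label `T`. -/
def subfileSize {Λ N B : ℕ} (σ : Splitting Λ N B) (n : Fin N) (T : Finset (Fin Λ)) : ℕ :=
  (Finset.univ.filter fun i : Fin B => σ n i = T).card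

/-- The placement of a splitting: the subfile with label `T` is copied into the caches of `T`. -/
def Splitting.placement {Λ N B : ℕ} (σ : Splitting Λ N B) : Placement Λ N B :=
  fun ℓ => Finset.univ.filter fun x : Fin N × Fin B => ℓ ∈ σ x.1 x.2

/-- The splitting of the basic MAN placement with parameter `t`: every file is split into
equal-sized subfiles (`s` bits each), one for every set of `t` caches. -/
def IsMAN {Λ N B : ℕ} (t s : ℕ) (σ : Splitting Λ N B) : Prop :=
  ∀ (n : Fin N) (T : Finset (Fin Λ)), subfileSize σ n T = if T.card = t then s else 0

/-- The splitting of the MAN placement with memory sharing between `t` and `t + 1`: every file is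
cut into two parts, the first one is treated by the basic MAN placement with parameter `t` and
subfiles of `s₁` bits, the second one by that with parameter `t + 1` and subfiles of `s₂` bits. -/
def IsSharedMAN {Λ N B : ℕ} (t s₁ s₂ : ℕ) (σ : Splitting Λ N B) : Prop :=
  ∀ (n : Fin N) (T : Finset (Fin Λ)),
    subfileSize σ n T = if T.card = t then s₁ else if T.card = t + 1 then s₂ else 0

/-- Splittings of the basic MAN placement exist for every file size divisible by `Λ.choose t`. -/
theorem exists_isMAN (Λ N t s : ℕ) :
    ∃ σ : Splitting Λ N (Λ.choose t * s), IsMAN t s σ := by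
  classical
  have hc : Fintype.card {T : Finset (Fin Λ) // T.card = t} = Λ.choose t := by simp
  let e : {T : Finset (Fin Λ) // T.card = t} ≃ Fin (Λ.choose t) := Fintype.equivFinOfCardEq hc
  let f : Fin (Λ.choose t * s) ≃ Fin (Λ.choose t) × Fin s := finProdFinEquiv.symm
  refine ⟨fun _ i => (e.symm (f i).1).1, fun n T => ?_⟩
  unfold subfileSize
  split_ifs with hT
  · have hinj : Function.Injective fun j : Fin s => f.symm (e ⟨T, hT⟩, j) := by
      intro j k hjk
      simpa using hjk
    have h : (Finset.univ.filter fun i => (e.symm (f i).1).1 = T)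
        = (Finset.univ : Finset (Fin s)).image fun j => f.symm (e ⟨T, hT⟩, j) := by
      ext i
      simp only [Finset.mem_filter, Finset.mem_univ, true_and, Finset.mem_image]
      constructor
      · intro hi
        refine ⟨(f i).2, ?_⟩
        have h1 : e.symm (f i).1 = ⟨T, hT⟩ := Subtype.ext hi
        rw [← h1]
        simp
      · rintro ⟨j, rfl⟩
        simp
    rw [h, Finset.card_image_of_injective _ hinj]
    simp
  · rw [Finset.card_eq_zero, Finset.filter_eq_empty_iff]
    intro i _ hi
    exact hT (hi ▸ (e.symm (f i).1).2)

end MACC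

/-!
Let `f t = ∑ j, K j * (Λ.choose (t + j) / Λ.choose t)` (`MACC.cornerLoad`). The optimal load at
memory `M` is the linear interpolation of `f` between the integers around `Λ * M / N`, the number of
copies of the library that fit into all the caches together, and MAN placements attain it.

*Delivery* (`MACC.delivers_placement`). For every set `S` of `t + j` caches and every `k < K j`, the
server sends the sum modulo `2` of the subfiles labelled `S \ U` requested by the `k`-th users
connected to the subsets `U ⊆ S` with `j` elements. A user connected to `U` misses only its own
subfile, because `S \ V` meets `U` for every other such `V`. Counting the bits sent gives the load
`f t` for the basic placement, and the interpolation for memory sharing.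

*Converse* (`MACC.sum_cornerLoad_le`). Fix an uncoded placement, a demand vector with
distinct requests (which exists since there are at most `N` users), and an order of the caches. The
requested bits that are stored only in caches after all those of the user requesting them can be
decoded from the broadcast alone, when all other bits are known to vanish
(`MACC.sum_card_filter_precedes_le`); so their number is at most the length of the broadcast. In a
random order, a set of `j` caches comes before a disjoint set of `t` caches with probability
`1 / (t + j).choose j`. Averaging over the orders and over the cyclic shifts of the demands shows
that the load is at least the average, over the bits of the library, of `f` at the number of caches
that hold the bit. The mean of that number is at most `Λ * M / N`, and `f` is convex and
nonincreasing, hence lies above each line through two consecutive points of its graph, whose slope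
is not positive; this turns the average into the interpolation.

For arbitrary real `M`, the fraction of memory sharing is approximated by a rational number. The loss
is small uniformly in the topology because `f` takes values between `0` and the number of users,
which is at most `N`.
-/

/-! ### Convex decreasing sequences and the corner loads -/

namespace MACC

/-- A nonnegative, nonincreasing, convex sequence of reals. -/
structure IsConvexDecreasing (f : ℕ → ℝ) : Prop where
  nonneg : ∀ n, 0 ≤ f n
  succ_le : ∀ n, f (n + 1) ≤ f n
  convex : ∀ n, 2 * f (n + 1) ≤ f n + f (n + 2)

namespace IsConvexDecreasing

variable {f g : ℕ → ℝ}

theorem const {c : ℝ} (hc : 0 ≤ c) : IsConvexDecreasing fun _ => c :=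
  ⟨fun _ => hc, fun _ => le_rfl, fun _ => by linarith⟩

theorem add (hf : IsConvexDecreasing f) (hg : IsConvexDecreasing g) :
    IsConvexDecreasing fun n => f n + g n :=
  ⟨fun n => add_nonneg (hf.nonneg n) (hg.nonneg n),
    fun n => add_le_add (hf.succ_le n) (hg.succ_le n),
    fun n => by linarith [hf.convex n, hg.convex n]⟩

theorem mul (hf : IsConvexDecreasing f) (hg : IsConvexDecreasing g) :
    IsConvexDecreasing fun n => f n * g n := by
  refine ⟨fun n => mul_nonneg (hf.nonneg n) (hg.nonneg n),
    fun n => mul_le_mul (hf.succ_le n) (hg.succ_le n) (hg.nonneg _) (hf.nonneg _), fun n => ?_⟩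
  have h1 := mul_nonneg (hf.nonneg (n + 1))
    (by linarith [hg.convex n] : 0 ≤ g n + g (n + 2) - 2 * g (n + 1))
  have h2 := mul_nonneg (hg.nonneg (n + 1))
    (by linarith [hf.convex n] : 0 ≤ f n + f (n + 2) - 2 * f (n + 1))
  have h3 := mul_nonneg (sub_nonneg.2 (hf.succ_le n)) (sub_nonneg.2 (hg.succ_le n))
  have h4 := mul_nonneg (sub_nonneg.2 (hf.succ_le (n + 1))) (sub_nonneg.2 (hg.succ_le (n + 1)))
  simp only [add_assoc, Nat.reduceAdd] at h4
  linear_combination h1 + h2 + h3 + h4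

theorem sum {ι : Type*} (s : Finset ι) {F : ι → ℕ → ℝ} (hF : ∀ i ∈ s, IsConvexDecreasing (F i)) :
    IsConvexDecreasing fun n => ∑ i ∈ s, F i n := by
  classical
  induction s using Finset.induction_on with
  | empty => simpa using const le_rfl
  | insert a s ha ih =>
    simp only [Finset.sum_insert ha]
    exact (hF a (Finset.mem_insert_self a s)).add
      (ih fun i hi => hF i (Finset.mem_insert_of_mem hi))

/-- A convex sequence lies above the line through two consecutive points. -/
theorem line_le (hf : IsConvexDecreasing f) (t j : ℕ) :
    f t - (f t - f (t + 1)) * (j - t) ≤ f j := by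
  have anti : Antitone fun n => f n - f (n + 1) :=
    antitone_nat_of_succ_le fun n => by
      have := hf.convex n
      simp only [add_assoc, Nat.reduceAdd]
      linarith
  rcases le_total t j with h | h
  · obtain ⟨k, rfl⟩ := Nat.exists_eq_add_of_le h
    clear h
    induction k with
    | zero => simp
    | succ k ih =>
      have := anti (Nat.le_add_right t k)
      simp only [add_assoc] at this
      push_cast at ih ⊢
      linarith
  · obtain ⟨k, rfl⟩ := Nat.exists_eq_add_of_le h
    clear h
    induction k with
    | zero => simp
    | succ k ih =>
      have h1 := anti (Nat.le_succ (j + k))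
      simp only [Nat.succ_eq_add_one] at h1
      have h2 := mul_le_mul_of_nonneg_right h1 (by positivity : (0 : ℝ) ≤ k + 1)
      push_cast at ih ⊢
      rw [← add_assoc]
      linarith

end IsConvexDecreasing

theorem isConvexDecreasing_choose_sub (n j : ℕ) :
    IsConvexDecreasing fun t => ((n - t).choose j : ℝ) := by
  cases j with
  | zero => simpa using IsConvexDecreasing.const zero_le_one
  | succ j =>
    refine ⟨fun t => by positivity, fun t => ?_, fun t => ?_⟩
    · exact_mod_cast Nat.choose_le_choose _ (by omega)
    · rcases Nat.lt_or_ge n (t + 2) with h | h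
      · have : n - (t + 1) = 0 := by omega
        simp only [this, Nat.choose_zero_succ]
        simp only [Nat.cast_zero, mul_zero]
        positivity
      · obtain ⟨m, rfl⟩ := Nat.exists_eq_add_of_le h
        have e0 : t + 2 + m - t = m + 1 + 1 := by omega
        have e1 : t + 2 + m - (t + 1) = m + 1 := by omega
        have e2 : t + 2 + m - (t + 2) = m := by omega
        have hm : m.choose j ≤ (m + 1).choose j := Nat.choose_le_succ m j
        have : 2 * (m + 1).choose (j + 1) ≤ (m + 1 + 1).choose (j + 1) + m.choose (j + 1) := by
          rw [Nat.choose_succ_succ (m + 1) j]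
          have := Nat.choose_succ_succ m j
          simp only [Nat.succ_eq_add_one] at *
          omega
        rw [e0, e1, e2]
        exact_mod_cast this

theorem isConvexDecreasing_inv_choose (j : ℕ) :
    IsConvexDecreasing fun t => ((t + j).choose j : ℝ)⁻¹ := by
  induction j with
  | zero => simpa using IsConvexDecreasing.const zero_le_one
  | succ j ih =>
    have key : (fun t : ℕ => ((t + (j + 1)).choose (j + 1) : ℝ)⁻¹)
        = fun t => ((t + j).choose j : ℝ)⁻¹ * ((j + 1) / (t + (j + 1))) := by
      funext t
      have h := Nat.add_one_mul_choose_eq (t + j) j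
      have h' : ((t : ℝ) + (j + 1)) * (t + j).choose j
          = (t + (j + 1)).choose (j + 1) * (j + 1) := by
        rw [← add_assoc, ← add_assoc]
        exact_mod_cast h
      have p1 : (0 : ℝ) < (t + j).choose j := by exact_mod_cast Nat.choose_pos (by omega)
      have p2 : (0 : ℝ) < (t + (j + 1)).choose (j + 1) := by
        exact_mod_cast Nat.choose_pos (by omega)
      have p3 : (0 : ℝ) < (t : ℝ) + (j + 1) := by positivity
      field_simp
      linarith
    rw [key]
    refine ih.mul ⟨fun t => by positivity, fun t => ?_, fun t => ?_⟩
    · push_cast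
      gcongr
      linarith
    · push_cast
      have p3 : (0 : ℝ) < (t : ℝ) + (j + 1) := by positivity
      have e : ((j : ℝ) + 1) / (t + (j + 1)) + (j + 1) / (t + 2 + (j + 1))
          - 2 * ((j + 1) / (t + 1 + (j + 1)))
          = 2 * (j + 1) / ((t + (j + 1)) * (t + 1 + (j + 1)) * (t + 2 + (j + 1))) := by
        field_simp
        ring
      have : (0 : ℝ) ≤ 2 * (j + 1) / ((t + (j + 1)) * (t + 1 + (j + 1)) * (t + 2 + (j + 1))) := by
        positivity
      linarith

/-- The worst-case load at the memory size `M = t * N / Λ`, for the generalized combinatorial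
topology with parameters `K`. The quotient of binomial coefficients equals
`Λ.choose (t + j) / Λ.choose t` if `t ≤ Λ`; in the form used here the sequence is convex on all of
`ℕ`, with the value `K 0` for `t ≥ Λ`. -/
noncomputable def cornerLoad (Λ : ℕ) (K : ℕ → ℕ) (t : ℕ) : ℝ :=
  ∑ j ∈ Finset.range (Λ + 1), (K j : ℝ) * (((Λ - t).choose j : ℝ) * ((t + j).choose j : ℝ)⁻¹)

theorem isConvexDecreasing_cornerLoad (Λ : ℕ) (K : ℕ → ℕ) :
    IsConvexDecreasing (cornerLoad Λ K) :=
  IsConvexDecreasing.sum _ fun j _ => (IsConvexDecreasing.const (K j).cast_nonneg).mul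
    ((isConvexDecreasing_choose_sub Λ j).mul (isConvexDecreasing_inv_choose j))

theorem cornerLoad_succ_self (Λ : ℕ) (K : ℕ → ℕ) :
    cornerLoad Λ K (Λ + 1) = cornerLoad Λ K Λ := by
  refine Finset.sum_congr rfl fun j _ => ?_
  cases j <;> simp

theorem choose_mul_cornerLoad (Λ : ℕ) (K : ℕ → ℕ) (t : ℕ) :
    (Λ.choose t : ℝ) * cornerLoad Λ K t
      = ∑ j ∈ Finset.range (Λ + 1), (K j : ℝ) * Λ.choose (t + j) := by
  rw [cornerLoad, Finset.mul_sum]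
  refine Finset.sum_congr rfl fun j _ => ?_
  have p : ((t + j).choose j : ℝ) ≠ 0 := by
    exact_mod_cast (Nat.choose_pos (Nat.le_add_left j t)).ne'
  have h : (Λ.choose t : ℝ) * (Λ - t).choose j = Λ.choose (t + j) * (t + j).choose j := by
    rcases Nat.lt_or_ge Λ (t + j) with h | h
    · rcases Nat.lt_or_ge Λ t with ht | ht
      · simp [Nat.choose_eq_zero_of_lt h, Nat.choose_eq_zero_of_lt ht]
      · simp [Nat.choose_eq_zero_of_lt h, Nat.choose_eq_zero_of_lt (by omega : Λ - t < j)]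
    · have := Nat.choose_mul (n := Λ) (Nat.le_add_right t j)
      rw [Nat.add_sub_cancel_left] at this
      rw [← Nat.choose_symm_add]
      exact_mod_cast this.symm
  field_simp
  linear_combination (K j : ℝ) * h

/-! ### The converse bound -/

/-- In the order `π` of the caches, all elements of `U` come before all elements of `T`. -/
def Precedes {Λ : ℕ} (π : Equiv.Perm (Fin Λ)) (U T : Finset (Fin Λ)) : Prop :=
  ∀ u ∈ U, ∀ v ∈ T, π u < π v

instance {Λ : ℕ} (π : Equiv.Perm (Fin Λ)) (U T : Finset (Fin Λ)) : Decidable (Precedes π U T) :=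
  inferInstanceAs (Decidable (∀ u ∈ U, ∀ v ∈ T, π u < π v))

theorem Precedes.disjoint {Λ : ℕ} {π : Equiv.Perm (Fin Λ)} {U T : Finset (Fin Λ)}
    (h : Precedes π U T) : Disjoint U T :=
  Finset.disjoint_left.2 fun x hU hT => lt_irrefl _ (h x hU x hT)

theorem exists_initial_segment {Λ : ℕ} (π : Equiv.Perm (Fin Λ)) (S : Finset (Fin Λ)) (j : ℕ)
    (hj : j ≤ S.card) : ∃ U ∈ S.powersetCard j, Precedes π U (S \ U) := by
  induction j with
  | zero => exact ⟨∅, by simp, by simp [Precedes]⟩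
  | succ j ih =>
    obtain ⟨U, hU, hprec⟩ := ih (by omega)
    rw [Finset.mem_powersetCard] at hU
    have hne : (S \ U).Nonempty := by
      rw [← Finset.card_pos, Finset.card_sdiff_of_subset hU.1]
      omega
    obtain ⟨x, hx, hmin⟩ := Finset.exists_min_image (S \ U) π hne
    have hx' := Finset.mem_sdiff.1 hx
    refine ⟨insert x U, Finset.mem_powersetCard.2 ⟨Finset.insert_subset hx'.1 hU.1, ?_⟩, ?_⟩
    · rw [Finset.card_insert_of_notMem hx'.2, hU.2]
    · intro u hu v hv
      rw [Finset.mem_sdiff, Finset.mem_insert, not_or] at hv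
      have hv' : v ∈ S \ U := Finset.mem_sdiff.2 ⟨hv.1, hv.2.2⟩
      rcases Finset.mem_insert.1 hu with rfl | hu
      · exact lt_of_le_of_ne (hmin v hv') fun h => hv.2.1 (π.injective h).symm
      · exact hprec u hu v hv'

theorem initial_segment_unique {Λ : ℕ} {π : Equiv.Perm (Fin Λ)} {S U V : Finset (Fin Λ)}
    (hU : U ⊆ S) (hV : V ⊆ S) (hc : U.card = V.card)
    (pU : Precedes π U (S \ U)) (pV : Precedes π V (S \ V)) : U = V := by
  by_cases h : U ⊆ V
  · exact Finset.eq_of_subset_of_card_le h hc.ge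
  · obtain ⟨x, hxU, hxV⟩ := Finset.not_subset.1 h
    refine (Finset.eq_of_subset_of_card_le (fun y hy => ?_) hc.le).symm
    by_contra hyU
    have h1 := pU x hxU y (Finset.mem_sdiff.2 ⟨hV hy, hyU⟩)
    have h2 := pV y hy x (Finset.mem_sdiff.2 ⟨hU hxU, hxV⟩)
    exact lt_asymm h1 h2

theorem card_filter_precedes_congr {Λ : ℕ} {S U V : Finset (Fin Λ)} (hU : U ⊆ S) (hV : V ⊆ S)
    (hc : U.card = V.card) :
    (Finset.univ.filter fun π => Precedes π U (S \ U)).card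
      = (Finset.univ.filter fun π => Precedes π V (S \ V)).card := by
  classical
  -- a permutation of the caches that preserves `S` and maps `U` to `V`
  have hfib : ∀ c : Prop × Prop,
      Nonempty ({x // ((x ∈ U, x ∈ S) : Prop × Prop) = c} ≃
        {x // ((x ∈ V, x ∈ S) : Prop × Prop) = c}) := by
    rintro ⟨p, q⟩
    refine ⟨Fintype.equivOfCardEq ?_⟩
    rw [Fintype.card_subtype, Fintype.card_subtype]
    have key : ∀ Y : Finset (Fin Λ), Y ⊆ S →
        (Finset.univ.filter fun x => ((x ∈ Y, x ∈ S) : Prop × Prop) = (p, q)).card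
          = if p then (if q then Y.card else 0) else (if q then S.card - Y.card else Λ - S.card) := by
      intro Y hY
      by_cases hp : p <;> by_cases hq : q <;> simp only [hp, hq, Prod.mk.injEq, if_true, if_false,
        eq_iff_iff, iff_true, iff_false]
      · congr 1
        ext x
        simpa using fun h => hY h
      · rw [Finset.card_eq_zero, Finset.filter_eq_empty_iff]
        exact fun x _ h => h.2 (hY h.1)
      · rw [← Finset.card_sdiff_of_subset hY]
        congr 1
        ext x
        simp [and_comm]
      · have : Λ - S.card = Sᶜ.card := by rw [Finset.card_compl, Fintype.card_fin]
        rw [this]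
        congr 1
        ext x
        simpa using fun h h' => h (hY h')
    rw [key U hU, key V hV, hc]
  let e := fun c => (hfib c).some
  let g : Equiv.Perm (Fin Λ) := Equiv.ofFiberEquiv e
  have hmap : ∀ x, (g x ∈ V ↔ x ∈ U) ∧ (g x ∈ S ↔ x ∈ S) := fun x => by
    have := Equiv.ofFiberEquiv_map e x
    simpa only [Prod.mk.injEq, eq_iff_iff] using this
  refine (Finset.card_bij (fun π _ => g.trans π) (fun π hπ => ?_) (fun π₁ _ π₂ _ h => ?_)
    fun π hπ => ⟨g.symm.trans π, ?_, ?_⟩).symm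
  · simp only [Finset.mem_filter, Finset.mem_univ, true_and] at hπ ⊢
    intro u hu v hv
    rw [Finset.mem_sdiff] at hv
    exact hπ (g u) ((hmap u).1.2 hu) (g v)
      (Finset.mem_sdiff.2 ⟨(hmap v).2.2 hv.1, fun h => hv.2 ((hmap v).1.1 h)⟩)
  · exact Equiv.ext fun x => by simpa using Equiv.congr_fun h (g.symm x)
  · simp only [Finset.mem_filter, Finset.mem_univ, true_and] at hπ ⊢
    intro u hu v hv
    rw [Finset.mem_sdiff] at hv
    have h1 := hmap (g.symm u)
    have h2 := hmap (g.symm v)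
    rw [Equiv.apply_symm_apply] at h1 h2
    exact hπ _ (h1.1.1 hu) _ (Finset.mem_sdiff.2 ⟨h2.2.1 hv.1, fun h => hv.2 (h2.1.2 h)⟩)
  · exact Equiv.ext fun x => by simp

/-- In a uniformly random order, a given set of `j` elements comes before a given disjoint set of
`t` elements with probability `1 / (t + j).choose j`: exactly one of the subsets with `j` elements
of the union is an initial segment of the union, and all are equally likely. -/
theorem choose_mul_card_filter_precedes {Λ : ℕ} {U T : Finset (Fin Λ)} (h : Disjoint U T) :
    (T.card + U.card).choose U.card * (Finset.univ.filter fun π => Precedes π U T).card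
      = Λ.factorial := by
  classical
  set S := U ∪ T with hS
  have hT : S \ U = T := by rw [hS, Finset.union_sdiff_cancel_left h]
  have hcard : S.card = T.card + U.card := by rw [hS, Finset.card_union_of_disjoint h, add_comm]
  have hUS : U ⊆ S := Finset.subset_union_left
  have h1 : ∑ V ∈ S.powersetCard U.card,
      (Finset.univ.filter fun π => Precedes π V (S \ V)).card
      = (T.card + U.card).choose U.card * (Finset.univ.filter fun π => Precedes π U T).card := by
    rw [Finset.sum_const_nat (m := (Finset.univ.filter fun π => Precedes π U T).card),
      Finset.card_powersetCard, hcard]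
    intro V hV
    rw [Finset.mem_powersetCard] at hV
    rw [card_filter_precedes_congr hV.1 hUS hV.2, hT]
  have h2 := Finset.sum_card_bipartiteAbove_eq_sum_card_bipartiteBelow
    (fun (V : Finset (Fin Λ)) (π : Equiv.Perm (Fin Λ)) => Precedes π V (S \ V))
    (s := S.powersetCard U.card) (t := Finset.univ)
  rw [← h1]
  refine h2.trans ?_
  rw [Finset.sum_const_nat (m := 1), Finset.card_univ, Fintype.card_perm, Fintype.card_fin, mul_one]
  intro π _
  obtain ⟨V, hV, hprec⟩ := exists_initial_segment π S U.card (Finset.card_le_card hUS)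
  rw [Finset.card_eq_one]
  refine ⟨V, Finset.ext fun V' => ?_⟩
  rw [Finset.mem_bipartiteBelow, Finset.mem_singleton]
  refine ⟨fun h' => ?_, fun h' => h' ▸ ⟨hV, hprec⟩⟩
  rw [Finset.mem_powersetCard] at hV
  have h'' := Finset.mem_powersetCard.1 h'.1
  exact initial_segment_unique h''.1 hV.1 (h''.2.trans hV.2.symm) h'.2 hprec

theorem sum_card_filter_precedes {Λ : ℕ} (K : ℕ → ℕ) (T : Finset (Fin Λ)) :
    ∑ U : Finset (Fin Λ), (K U.card : ℝ) * (Finset.univ.filter fun π => Precedes π U T).card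
      = Λ.factorial * cornerLoad Λ K T.card := by
  classical
  rw [← Finset.powerset_univ, Finset.sum_powerset, Finset.card_univ, Fintype.card_fin, cornerLoad,
    Finset.mul_sum]
  refine Finset.sum_congr rfl fun j _ => ?_
  have hsub : Finset.powersetCard j Tᶜ ⊆ Finset.powersetCard j Finset.univ :=
    Finset.powersetCard_mono (Finset.subset_univ _)
  rw [← Finset.sum_subset hsub]
  · have hc : (Finset.powersetCard j Tᶜ).card = (Λ - T.card).choose j := by
      rw [Finset.card_powersetCard, Finset.card_compl, Fintype.card_fin]
    have hp : ((T.card + j).choose j : ℝ) ≠ 0 := by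
      exact_mod_cast (Nat.choose_pos (Nat.le_add_left j T.card)).ne'
    rw [Finset.sum_congr rfl (g := fun _ =>
        (K j : ℝ) * (Λ.factorial * ((T.card + j).choose j : ℝ)⁻¹)), Finset.sum_const, hc,
      nsmul_eq_mul]
    · ring
    · intro U hU
      obtain ⟨hUT, rfl⟩ := Finset.mem_powersetCard.1 hU
      have hdis : Disjoint U T := Finset.disjoint_left.2 fun x hx =>
        Finset.mem_compl.1 (hUT hx)
      rw [← choose_mul_card_filter_precedes hdis]
      push_cast
      field_simp
  · intro U hU hU'
    have : ¬ Disjoint U T := fun hdis => hU' (Finset.mem_powersetCard.2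
      ⟨fun x hx => Finset.mem_compl.2 (Finset.disjoint_left.1 hdis hx),
        (Finset.mem_powersetCard.1 hU).2⟩)
    rw [Finset.filter_eq_empty_iff.2 fun π _ hπ => this hπ.disjoint]
    simp

/-- The set of caches that hold a given bit of the library. -/
def holders {Λ N B : ℕ} (P : Placement Λ N B) (x : Fin N × Fin B) : Finset (Fin Λ) :=
  Finset.univ.filter fun ℓ => x ∈ P ℓ

theorem mem_holders {Λ N B : ℕ} {P : Placement Λ N B} {x : Fin N × Fin B} {ℓ : Fin Λ} :
    ℓ ∈ holders P x ↔ x ∈ P ℓ := by simp [holders]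

theorem sum_card_holders {Λ N B : ℕ} (P : Placement Λ N B) :
    ∑ x, (holders P x).card = ∑ ℓ, (P ℓ).card := by
  have := Finset.sum_card_bipartiteAbove_eq_sum_card_bipartiteBelow
    (fun (x : Fin N × Fin B) (ℓ : Fin Λ) => x ∈ P ℓ) (s := Finset.univ) (t := Finset.univ)
  simpa [holders, Finset.bipartiteAbove, Finset.bipartiteBelow] using this

/-- The acyclic index coding bound for an order `π` of the caches. A library that vanishes outside
the bits counted on the left can be recovered from the broadcast alone: visit the users by the
position of their last cache; a counted bit that a user has in its caches was
requested by a user visited earlier. -/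
theorem sum_card_filter_precedes_le {Λ N B L : ℕ} {b : Connectivity Λ} {P : Placement Λ N B}
    {d : User b → Fin N} (hd : Function.Injective d) (h : Delivers b P d L)
    (π : Equiv.Perm (Fin Λ)) :
    ∑ u : User b, (Finset.univ.filter fun i => Precedes π u.1 (holders P (d u, i))).card ≤ L := by
  classical
  obtain ⟨encode, decode, hdec⟩ := h
  set X : Finset (Fin N × Fin B) :=
    Finset.univ.filter fun x => ∃ u, d u = x.1 ∧ Precedes π u.1 (holders P x)
  have hle : ∑ u : User b, (Finset.univ.filter fun i => Precedes π u.1 (holders P (d u, i))).card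
      ≤ X.card := by
    rw [← Finset.card_sigma]
    refine Finset.card_le_card_of_injOn (fun p => (d p.1, p.2)) ?_ ?_
    · rintro ⟨u, i⟩ hi
      have hi' : Precedes π u.1 (holders P (d u, i)) := by simpa using hi
      exact Finset.mem_filter.2 ⟨Finset.mem_univ _, u, rfl, hi'⟩
    · rintro ⟨u, i⟩ _ ⟨u', i'⟩ _ heq
      simp only [Prod.mk.injEq] at heq
      obtain rfl := hd heq.1
      rw [heq.2]
  refine hle.trans ?_
  let lib : (X → Bool) → Library N B := fun y n i =>
    if hx : (n, i) ∈ X then y ⟨(n, i), hx⟩ else false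
  have hinj : Function.Injective fun y => encode (lib y) := by
    intro y y' hyy
    simp only at hyy
    let rank : User b → ℕ := fun u => u.1.sup fun ℓ => (π ℓ : ℕ) + 1
    have main : ∀ r, ∀ u : User b, rank u = r → lib y (d u) = lib y' (d u) := by
      intro r
      induction r using Nat.strong_induction_on with
      | _ r ih =>
        intro u hu
        have hcache : cacheContents P u.1 (lib y) = cacheContents P u.1 (lib y') := by
          funext x
          obtain ⟨⟨n, i⟩, hx⟩ := x
          by_cases hxX : (n, i) ∈ X
          · obtain ⟨u', hu', hprec⟩ := (Finset.mem_filter.1 hxX).2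
            simp only at hu'
            obtain ⟨ℓ, hℓ, hxℓ⟩ := Finset.mem_biUnion.1 hx
            have hlt : rank u' < rank u :=
              calc rank u' < (π ℓ : ℕ) + 1 := by
                    refine (Finset.sup_lt_iff (Nat.succ_pos _)).2 fun ℓ' hℓ' => ?_
                    exact Nat.succ_lt_succ (hprec ℓ' hℓ' ℓ (mem_holders.2 hxℓ))
                _ ≤ rank u := Finset.le_sup (f := fun ℓ => (π ℓ : ℕ) + 1) hℓ
            have := ih (rank u') (hu ▸ hlt) u' rfl
            rw [hu'] at this
            exact congrFun this i
          · simp [cacheContents, lib, hxX]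
        rw [← hdec (lib y) u, ← hdec (lib y') u, hcache, hyy]
    funext x
    obtain ⟨⟨n, i⟩, hx⟩ := x
    obtain ⟨u, hu, -⟩ := (Finset.mem_filter.1 hx).2
    have := congrFun (main _ u rfl) i
    simp only at hu
    rw [hu] at this
    simpa [lib, hx] using this
  have hcard := Fintype.card_le_of_injective _ hinj
  simp only [Fintype.card_fun, Fintype.card_bool, Fintype.card_coe, Fintype.card_fin] at hcard
  exact (Nat.pow_le_pow_iff_right one_lt_two).1 hcard

/-- The average of the acyclic index coding bounds over all orders of the caches and over the cyclic
shifts of a demand vector with distinct requests. -/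
theorem sum_cornerLoad_le {Λ N B : ℕ} {b : Connectivity Λ} {K : ℕ → ℕ} (hb : ∀ U, b U = K U.card)
    (hN : 0 < N) (hK : Fintype.card (User b) ≤ N) {P : Placement Λ N B} {R : ℝ}
    (h : GuaranteesLoad b P R) :
    ∑ x, cornerLoad Λ K (holders P x).card ≤ N * (R * B) := by
  classical
  have : NeZero N := ⟨hN.ne'⟩
  obtain ⟨d₀⟩ : Nonempty (User b ↪ Fin N) :=
    Function.Embedding.nonempty_of_card_le (by simpa using hK)
  have hπ : ∀ π : Equiv.Perm (Fin Λ), ∑ U : Finset (Fin Λ), (K U.card : ℝ) *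
      (Finset.univ.filter fun x => Precedes π U (holders P x)).card ≤ N * (R * B) := by
    intro π
    have hshift : ∀ c : Fin N, ∑ u : User b, ((Finset.univ.filter fun i =>
        Precedes π u.1 (holders P (c + d₀ u, i))).card : ℝ) ≤ R * B := by
      intro c
      obtain ⟨L, hL, hdel⟩ := h fun u => c + d₀ u
      refine le_trans ?_ hL
      exact_mod_cast sum_card_filter_precedes_le
        (fun u v huv => d₀.injective (add_left_cancel huv)) hdel π
    have hsum := Finset.sum_le_sum fun c (_ : c ∈ Finset.univ) => hshift c
    rw [Finset.sum_const, Finset.card_univ, Fintype.card_fin, nsmul_eq_mul] at hsum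
    refine le_trans (le_of_eq ?_) hsum
    rw [Finset.sum_comm, Fintype.sum_sigma]
    refine Finset.sum_congr rfl fun U _ => ?_
    have hu : ∀ k : Fin (b U), ∑ c : Fin N, ((Finset.univ.filter fun i =>
        Precedes π U (holders P (c + d₀ ⟨U, k⟩, i))).card : ℝ)
        = (Finset.univ.filter fun x => Precedes π U (holders P x)).card := by
      intro k
      refine (Equiv.sum_comp (Equiv.addRight (d₀ ⟨U, k⟩)) fun n => ((Finset.univ.filter fun i =>
        Precedes π U (holders P (n, i))).card : ℝ)).trans ?_
      simp only [Finset.card_filter, Nat.cast_sum]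
      rw [Fintype.sum_prod_type]
    rw [Finset.sum_congr rfl fun k _ => hu k, Finset.sum_const, Finset.card_univ, Fintype.card_fin,
      hb, nsmul_eq_mul]
  have htotal := Finset.sum_le_sum fun π (_ : π ∈ Finset.univ) => hπ π
  rw [Finset.sum_const, Finset.card_univ, Fintype.card_perm, Fintype.card_fin,
    nsmul_eq_mul] at htotal
  have hswap : ∑ π : Equiv.Perm (Fin Λ), ∑ U : Finset (Fin Λ), (K U.card : ℝ) *
      (Finset.univ.filter fun x => Precedes π U (holders P x)).card
      = Λ.factorial * ∑ x, cornerLoad Λ K (holders P x).card := by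
    rw [Finset.mul_sum]
    simp_rw [← sum_card_filter_precedes]
    rw [Finset.sum_comm, Finset.sum_comm (s := Finset.univ (α := Fin N × Fin B))]
    refine Finset.sum_congr rfl fun U _ => ?_
    rw [← Finset.mul_sum, ← Finset.mul_sum]
    congr 1
    exact_mod_cast Finset.sum_card_bipartiteAbove_eq_sum_card_bipartiteBelow
      (fun (π : Equiv.Perm (Fin Λ)) (x : Fin N × Fin B) => Precedes π U (holders P x))
  rw [hswap] at htotal
  exact le_of_mul_le_mul_left htotal (by exact_mod_cast Λ.factorial_pos)

/-- The converse: every achievable load lies above each line through two consecutive corner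
points. -/
theorem line_le_of_achievable {Λ N : ℕ} {b : Connectivity Λ} {K : ℕ → ℕ}
    (hb : ∀ U, b U = K U.card) (hN : 0 < N) (hK : Fintype.card (User b) ≤ N) {M R : ℝ}
    (h : Achievable b N M R) (t : ℕ) :
    cornerLoad Λ K t - (cornerLoad Λ K t - cornerLoad Λ K (t + 1)) * (Λ * M / N - t) ≤ R := by
  obtain ⟨B, hB, P, hM, hR⟩ := h
  have hf := isConvexDecreasing_cornerLoad Λ K
  have h1 := sum_cornerLoad_le hb hN hK hR
  have h2 := Finset.sum_le_sum fun (x : Fin N × Fin B) (_ : x ∈ Finset.univ) =>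
    hf.line_le t (holders P x).card
  have h3 : (∑ x, ((holders P x).card : ℝ)) ≤ Λ * (M * B) := by
    have := Finset.sum_le_sum fun ℓ (_ : ℓ ∈ Finset.univ) => hM ℓ
    rw [Finset.sum_const, Finset.card_univ, Fintype.card_fin, nsmul_eq_mul] at this
    rw [← Nat.cast_sum, sum_card_holders, Nat.cast_sum]
    exact this
  rw [Finset.sum_sub_distrib, ← Finset.mul_sum, Finset.sum_sub_distrib, Finset.sum_const,
    Finset.sum_const, Finset.card_univ, Fintype.card_prod, Fintype.card_fin, Fintype.card_fin,
    nsmul_eq_mul, nsmul_eq_mul] at h2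
  push_cast at h2
  have h4 := mul_le_mul_of_nonneg_left h3 (sub_nonneg.2 (hf.succ_le t))
  have hB' : (0 : ℝ) < B := by exact_mod_cast hB
  have hN' : (0 : ℝ) < N := by exact_mod_cast hN
  refine le_of_mul_le_mul_left ?_ (mul_pos hN' hB')
  have e : (N * B : ℝ) * (cornerLoad Λ K t
      - (cornerLoad Λ K t - cornerLoad Λ K (t + 1)) * (Λ * M / N - t))
      = N * B * cornerLoad Λ K t - (cornerLoad Λ K t - cornerLoad Λ K (t + 1)) *
        (Λ * (M * B) - N * B * t) := by
    field_simp
  rw [e]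
  linarith

/-! ### The delivery scheme -/

/-- A broadcast of `L` bits suffices if some function of the library with at most `2 ^ L` values
determines, jointly with the accessible caches, the requested file of each user. -/
theorem delivers_of_determines {Λ N B L : ℕ} {b : Connectivity Λ} {P : Placement Λ N B}
    {d : User b → Fin N} {Y : Type*} [Fintype Y] (enc : Library N B → Y)
    (hY : Fintype.card Y ≤ 2 ^ L)
    (h : ∀ u W W', enc W = enc W' → cacheContents P u.1 W = cacheContents P u.1 W' →
      W (d u) = W' (d u)) : Delivers b P d L := by
  classical
  obtain ⟨φ⟩ : Nonempty (Y ↪ (Fin L → Bool)) :=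
    Function.Embedding.nonempty_of_card_le (by simpa using hY)
  refine ⟨fun W => φ (enc W), fun u y z =>
    if hW : ∃ W, φ (enc W) = y ∧ cacheContents P u.1 W = z then hW.choose (d u)
    else fun _ => false, fun W u => ?_⟩
  have hW : ∃ W', φ (enc W') = φ (enc W) ∧ cacheContents P u.1 W' = cacheContents P u.1 W :=
    ⟨W, rfl, rfl⟩
  simp only [dif_pos hW]
  exact h u _ _ (φ.injective hW.choose_spec.1) hW.choose_spec.2

section Subfiles

variable {Λ N B : ℕ} (σ : Splitting Λ N B)

/-- The index of a bit within its subfile. -/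
def indexInSubfile (n : Fin N) (i : Fin B) : ℕ :=
  (Finset.univ.filter fun j => j < i ∧ σ n j = σ n i).card

theorem indexInSubfile_lt (n : Fin N) (i : Fin B) :
    indexInSubfile σ n i < subfileSize σ n (σ n i) := by
  refine Finset.card_lt_card (Finset.ssubset_iff_of_subset (fun j hj => ?_) |>.2 ⟨i, ?_, ?_⟩)
  · simp only [Finset.mem_filter, Finset.mem_univ, true_and] at hj ⊢
    exact hj.2
  · simp
  · simp

theorem indexInSubfile_lt_of_lt {n : Fin N} {i j : Fin B} (h : σ n i = σ n j) (hij : i < j) :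
    indexInSubfile σ n i < indexInSubfile σ n j := by
  refine Finset.card_lt_card (Finset.ssubset_iff_of_subset (fun k hk => ?_) |>.2 ⟨i, ?_, ?_⟩)
  · simp only [Finset.mem_filter, Finset.mem_univ, true_and] at hk ⊢
    exact ⟨hk.1.trans hij, hk.2.trans h⟩
  · simp [hij, h]
  · simp

theorem indexInSubfile_inj {n : Fin N} {i j : Fin B} (h : σ n i = σ n j)
    (hij : indexInSubfile σ n i = indexInSubfile σ n j) : i = j := by
  rcases lt_trichotomy i j with hlt | heq | hgt
  · exact absurd hij (indexInSubfile_lt_of_lt σ h hlt).ne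
  · exact heq
  · exact absurd hij (indexInSubfile_lt_of_lt σ h.symm hgt).ne'

/-- The bit with index `r` of the subfile of the `n`-th file with label `T`, as an element of
`ZMod 2`; it is `0` if the subfile has at most `r` bits. -/
def subfileBit (W : Library N B) (n : Fin N) (T : Finset (Fin Λ)) (r : ℕ) : ZMod 2 :=
  ∑ i with σ n i = T ∧ indexInSubfile σ n i = r, if W n i then 1 else 0

theorem subfileBit_congr {W W' : Library N B} {n : Fin N} {T : Finset (Fin Λ)}
    (h : ∀ i, σ n i = T → W n i = W' n i) (r : ℕ) :
    subfileBit σ W n T r = subfileBit σ W' n T r :=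
  Finset.sum_congr rfl fun i hi => by rw [h i (Finset.mem_filter.1 hi).2.1]

theorem subfileBit_self (W : Library N B) (n : Fin N) (i : Fin B) :
    subfileBit σ W n (σ n i) (indexInSubfile σ n i) = if W n i then 1 else 0 := by
  have : (Finset.univ.filter fun j => σ n j = σ n i ∧
      indexInSubfile σ n j = indexInSubfile σ n i) = {i} := by
    ext j
    simp only [Finset.mem_filter, Finset.mem_univ, true_and, Finset.mem_singleton]
    exact ⟨fun h => indexInSubfile_inj σ h.1 h.2, fun h => by simp [h]⟩
  rw [subfileBit, this, Finset.sum_singleton]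

theorem mem_placement {n : Fin N} {i : Fin B} {ℓ : Fin Λ} :
    (n, i) ∈ σ.placement ℓ ↔ ℓ ∈ σ n i := by
  simp [Splitting.placement]

end Subfiles

/-- The delivery scheme. For every set `S` of `t + j` caches, the subfiles with label `S \ U`
requested by the `k`-th users connected to the subsets `U` of `S` with `j` elements are added
modulo `2`. Each of these users has all the other terms of the sum in its caches, because
two different subsets of `S` of the same size are not contained in each other. -/
theorem delivers_placement {Λ N B : ℕ} {b : Connectivity Λ} {K : ℕ → ℕ}
    (hb : ∀ U, b U = K U.card) {σ : Splitting Λ N B} {s : ℕ → ℕ}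
    (hσ : ∀ n T, subfileSize σ n T = s T.card) (d : User b → Fin N) :
    Delivers b σ.placement d (∑ j ∈ Finset.range (Λ + 1), ∑ t ∈ Finset.range (Λ + 2),
      K j * (Λ.choose (t + j) * s t)) := by
  classical
  let I : Type := Σ j : Fin (Λ + 1), Σ t : Fin (Λ + 2),
    Fin (K j) × {S : Finset (Fin Λ) // S.card = (t : ℕ) + j} × Fin (s t)
  let enc : Library N B → I → ZMod 2 := fun W x =>
    ∑ U ∈ (x.2.2.2.1 : Finset (Fin Λ)).powersetCard x.1,
      if h : (x.2.2.1 : ℕ) < b U then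
        subfileBit σ W (d ⟨U, x.2.2.1, h⟩) ((x.2.2.2.1 : Finset (Fin Λ)) \ U) x.2.2.2.2
      else 0
  refine delivers_of_determines enc (le_of_eq ?_) ?_
  · rw [Fintype.card_fun, ZMod.card]
    congr 1
    simp only [I, Fintype.card_sigma, Fintype.card_prod, Fintype.card_fin,
      Fintype.card_finset_len, Finset.sum_range]
  · rintro ⟨U, k⟩ W W' henc hcache
    funext i
    -- users know the subfiles whose labels meet their set of caches
    have hknown : ∀ n i', ¬ Disjoint U (σ n i') → W n i' = W' n i' := by
      intro n i' hdis
      obtain ⟨ℓ, hℓ, hℓ'⟩ := Finset.not_disjoint_iff.1 hdis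
      exact congrFun hcache ⟨(n, i'), Finset.mem_biUnion.2 ⟨ℓ, hℓ, (mem_placement σ).2 hℓ'⟩⟩
    by_cases hdis : Disjoint U (σ (d ⟨U, k⟩) i)
    swap
    · exact hknown _ _ hdis
    set n := d ⟨U, k⟩ with hn
    set T := σ n i with hT
    have hcard : ∀ V : Finset (Fin Λ), V.card ≤ Λ := fun V => by
      simpa using V.card_le_univ
    have hr : indexInSubfile σ n i < s T.card := by
      rw [← hσ n T]
      exact indexInSubfile_lt σ n i
    let x : I := ⟨⟨U.card, Nat.lt_succ_of_le (hcard U)⟩,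
      ⟨T.card, Nat.lt_succ_of_le ((hcard T).trans Λ.le_succ)⟩,
      ⟨k, hb U ▸ k.2⟩, ⟨U ∪ T, by rw [Finset.card_union_of_disjoint hdis, add_comm]⟩,
      ⟨indexInSubfile σ n i, hr⟩⟩
    have hx : enc W x = enc W' x := congrFun henc x
    simp only [enc, x] at hx
    have hU : U ∈ (U ∪ T).powersetCard U.card :=
      Finset.mem_powersetCard.2 ⟨Finset.subset_union_left, rfl⟩
    rw [← Finset.add_sum_erase _ _ hU, ← Finset.add_sum_erase _ _ hU, dif_pos k.2, dif_pos k.2,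
      Finset.union_sdiff_cancel_left hdis] at hx
    rw [Finset.sum_congr (g := fun V => if h : (k : ℕ) < b V then
      subfileBit σ W' (d ⟨V, k, h⟩) ((U ∪ T) \ V) (indexInSubfile σ n i) else 0) rfl] at hx
    · have hbit := add_right_cancel hx
      simp only [Fin.eta] at hbit
      rw [← hn, hT, subfileBit_self, subfileBit_self] at hbit
      revert hbit
      cases W n i <;> cases W' n i <;> decide
    · intro V hV
      obtain ⟨hne, hV⟩ := Finset.mem_erase.1 hV
      obtain ⟨hVS, hVc⟩ := Finset.mem_powersetCard.1 hV
      split_ifs with h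
      · refine subfileBit_congr σ (fun i' hi' => hknown _ _ ?_) _
        rw [hi']
        intro hdis'
        refine hne (Finset.eq_of_subset_of_card_le (fun ℓ hℓ => ?_) hVc.le).symm
        by_contra hℓV
        exact Finset.disjoint_left.1 hdis' hℓ
          (Finset.mem_sdiff.2 ⟨Finset.mem_union_left _ hℓ, hℓV⟩)
      · rfl

/-! ### MAN placements and their optimality -/

theorem sum_range_mul_shared {Λ t : ℕ} (ht : t ≤ Λ) (s₁ s₂ : ℕ) (g : ℕ → ℕ) :
    ∑ m ∈ Finset.range (Λ + 2), g m * (if m = t then s₁ else if m = t + 1 then s₂ else 0)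
      = g t * s₁ + g (t + 1) * s₂ := by
  have : ∀ m, g m * (if m = t then s₁ else if m = t + 1 then s₂ else 0)
      = (if m = t then g t * s₁ else 0) + if m = t + 1 then g (t + 1) * s₂ else 0 := by
    intro m
    split_ifs with h1 h2 h2
    · omega
    · simp [h1]
    · simp [h2]
    · simp
  simp_rw [this]
  rw [Finset.sum_add_distrib, Finset.sum_ite_eq', Finset.sum_ite_eq',
    if_pos (Finset.mem_range.2 (by omega)), if_pos (Finset.mem_range.2 (by omega))]

theorem sum_shared {Λ t : ℕ} (ht : t ≤ Λ) (s₁ s₂ : ℕ) :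
    ∑ T : Finset (Fin Λ), (if T.card = t then s₁ else if T.card = t + 1 then s₂ else 0)
      = Λ.choose t * s₁ + Λ.choose (t + 1) * s₂ := by
  rw [← sum_range_mul_shared ht s₁ s₂ Λ.choose, Finset.sum_range_succ, Nat.choose_succ_self,
    zero_mul, add_zero, ← Finset.powerset_univ,
    Finset.sum_powerset_apply_card fun c => if c = t then s₁ else if c = t + 1 then s₂ else 0]
  simp

theorem card_filter_mem_powersetCard_mul {Λ : ℕ} (ℓ : Fin Λ) (m : ℕ) :
    ((Finset.powersetCard m Finset.univ).filter fun T => ℓ ∈ T).card * Λ = m * Λ.choose m := by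
  obtain ⟨k, rfl⟩ : ∃ k, Λ = k + 1 := ⟨Λ - 1, by have := ℓ.pos; omega⟩
  have h1 : (Finset.powersetCard m Finset.univ).filter (fun T => ¬ ℓ ∈ T)
      = Finset.powersetCard m (Finset.univ.erase ℓ) := by
    ext T
    simp only [Finset.mem_filter, Finset.mem_powersetCard, Finset.subset_univ, true_and,
      Finset.subset_erase]
    exact and_comm
  have h2 := Finset.card_filter_add_card_filter_not (s := Finset.powersetCard m
    (Finset.univ : Finset (Fin (k + 1)))) fun T => ℓ ∈ T
  rw [h1, Finset.card_powersetCard, Finset.card_powersetCard, Finset.card_erase_of_mem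
    (Finset.mem_univ _), Finset.card_univ, Fintype.card_fin, Nat.add_sub_cancel] at h2
  cases m with
  | zero => simp
  | succ m =>
    rw [Nat.choose_succ_succ] at h2
    have h3 : ((Finset.powersetCard (m + 1) Finset.univ).filter fun T => ℓ ∈ T).card
        = k.choose m := by
      simp only [Nat.succ_eq_add_one] at h2
      omega
    rw [h3, mul_comm, Nat.add_one_mul_choose_eq, mul_comm]

section Shared

variable {Λ N B t s₁ s₂ : ℕ} {σ : Splitting Λ N B}

theorem IsMAN.isSharedMAN {s : ℕ} (h : IsMAN t s σ) : IsSharedMAN t s 0 σ := fun n T => by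
  rw [h n T]
  simp

theorem IsSharedMAN.fileSize_eq (hσ : IsSharedMAN t s₁ s₂ σ) (ht : t ≤ Λ) (hN : 0 < N) :
    B = Λ.choose t * s₁ + Λ.choose (t + 1) * s₂ := by
  classical
  rw [← sum_shared ht, ← Finset.sum_congr rfl fun T _ => hσ ⟨0, hN⟩ T]
  have h := Finset.card_eq_sum_card_fiberwise (s := Finset.univ) (t := Finset.univ)
    (f := σ ⟨0, hN⟩) fun _ _ => by simp
  rw [Finset.card_univ, Fintype.card_fin] at h
  exact h

theorem IsSharedMAN.card_placement_mul (hσ : IsSharedMAN t s₁ s₂ σ) (ht : t ≤ Λ) (ℓ : Fin Λ) :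
    (σ.placement ℓ).card * Λ
      = N * (t * (Λ.choose t * s₁) + (t + 1) * (Λ.choose (t + 1) * s₂)) := by
  classical
  have h1 : ∀ n, (Finset.univ.filter fun i => ℓ ∈ σ n i).card
      = ∑ T : Finset (Fin Λ), if ℓ ∈ T then
          (if T.card = t then s₁ else if T.card = t + 1 then s₂ else 0) else 0 := by
    intro n
    rw [Finset.card_eq_sum_card_fiberwise (t := Finset.univ) (f := σ n) fun _ _ => by simp]
    refine Finset.sum_congr rfl fun T _ => ?_
    rw [← hσ n T, subfileSize, Finset.filter_filter]
    split_ifs with hT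
    · congr 1
      ext i
      simp only [Finset.mem_filter, Finset.mem_univ, true_and]
      exact ⟨fun h => h.2, fun h => ⟨h ▸ hT, h⟩⟩
    · rw [Finset.card_eq_zero, Finset.filter_eq_empty_iff]
      rintro i - ⟨hi, rfl⟩
      exact hT hi
  have h2 : (σ.placement ℓ).card = ∑ n, (Finset.univ.filter fun i => ℓ ∈ σ n i).card := by
    simp only [Splitting.placement, Finset.card_filter]
    rw [Fintype.sum_prod_type]
  rw [h2, Finset.sum_congr rfl fun n _ => h1 n, Finset.sum_const, Finset.card_univ,
    Fintype.card_fin, smul_eq_mul, mul_assoc]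
  congr 1
  have h3 := sum_range_mul_shared ht s₁ s₂ fun m => m * Λ.choose m
  simp only [mul_assoc] at h3
  rw [← h3, ← Finset.powerset_univ, Finset.sum_powerset, Finset.card_univ, Fintype.card_fin,
    Finset.sum_range_succ _ (Λ + 1), Nat.choose_succ_self, zero_mul, mul_zero, add_zero,
    Finset.sum_mul]
  refine Finset.sum_congr rfl fun m _ => ?_
  rw [← mul_assoc, ← card_filter_mem_powersetCard_mul ℓ m, ← Finset.sum_filter,
    Finset.sum_congr rfl (g := fun _ => if m = t then s₁ else if m = t + 1 then s₂ else 0),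
    Finset.sum_const, smul_eq_mul]
  · ring
  · intro T hT
    rw [(Finset.mem_powersetCard.1 (Finset.mem_filter.1 hT).1).2]

/-- Up to the factor `Λ`, the memory occupied in a cache; `Λ.choose (t + 1) * s₂ / B` is the
fraction of each file that is treated with the parameter `t + 1`. -/
theorem IsSharedMAN.card_placement (hσ : IsSharedMAN t s₁ s₂ σ) (ht : t ≤ Λ) (hB : 0 < B)
    (hN : 0 < N) (ℓ : Fin Λ) :
    ((σ.placement ℓ).card : ℝ) * Λ = N * B * (t + (Λ.choose (t + 1) * s₂ / B : ℝ)) := by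
  have hB' : (B : ℝ) ≠ 0 := by exact_mod_cast hB.ne'
  have h1 : ((σ.placement ℓ).card : ℝ) * Λ
      = N * (t * (Λ.choose t * s₁) + (t + 1) * (Λ.choose (t + 1) * s₂)) := by
    exact_mod_cast hσ.card_placement_mul ht ℓ
  have h2 : (B : ℝ) = Λ.choose t * s₁ + Λ.choose (t + 1) * s₂ := by
    exact_mod_cast hσ.fileSize_eq ht hN
  rw [h1]
  field_simp
  rw [h2]
  ring

/-- The load of the delivery scheme is the linear interpolation between two corner points. -/
theorem IsSharedMAN.guaranteesLoad (hσ : IsSharedMAN t s₁ s₂ σ) (ht : t ≤ Λ) (hB : 0 < B)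
    (hN : 0 < N) {b : Connectivity Λ} {K : ℕ → ℕ} (hb : ∀ U, b U = K U.card) :
    GuaranteesLoad b σ.placement (cornerLoad Λ K t -
      (cornerLoad Λ K t - cornerLoad Λ K (t + 1)) * (Λ.choose (t + 1) * s₂ / B)) := by
  intro d
  refine ⟨_, le_of_eq ?_, delivers_placement hb
    (s := fun c => if c = t then s₁ else if c = t + 1 then s₂ else 0) hσ d⟩
  have hB' : (B : ℝ) ≠ 0 := by exact_mod_cast hB.ne'
  have h2 : (B : ℝ) = Λ.choose t * s₁ + Λ.choose (t + 1) * s₂ := by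
    exact_mod_cast hσ.fileSize_eq ht hN
  have h3 : ∀ j, ∑ m ∈ Finset.range (Λ + 2), K j * (Λ.choose (m + j) *
      (if m = t then s₁ else if m = t + 1 then s₂ else 0))
      = K j * Λ.choose (t + j) * s₁ + K j * Λ.choose (t + 1 + j) * s₂ := by
    intro j
    have := sum_range_mul_shared ht s₁ s₂ fun m => K j * Λ.choose (m + j)
    simpa only [mul_assoc] using this
  have h4 : ((∑ j ∈ Finset.range (Λ + 1), ∑ m ∈ Finset.range (Λ + 2), K j * (Λ.choose (m + j) *
      (if m = t then s₁ else if m = t + 1 then s₂ else 0)) : ℕ) : ℝ)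
      = Λ.choose t * cornerLoad Λ K t * s₁ + Λ.choose (t + 1) * cornerLoad Λ K (t + 1) * s₂ := by
    rw [Finset.sum_congr rfl fun j _ => h3 j, choose_mul_cornerLoad, choose_mul_cornerLoad,
      Finset.sum_mul, Finset.sum_mul, ← Finset.sum_add_distrib]
    push_cast
    rfl
  rw [h4]
  field_simp
  rw [h2]
  ring

end Shared

theorem exists_isSharedMAN {Λ t : ℕ} (ht : t ≤ Λ) (N s₁ s₂ : ℕ) :
    ∃ σ : Splitting Λ N (Λ.choose t * s₁ + Λ.choose (t + 1) * s₂), IsSharedMAN t s₁ s₂ σ := by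
  classical
  let size : Finset (Fin Λ) → ℕ := fun T =>
    if T.card = t then s₁ else if T.card = t + 1 then s₂ else 0
  have hc : Fintype.card (Σ T : Finset (Fin Λ), Fin (size T))
      = Fintype.card (Fin (Λ.choose t * s₁ + Λ.choose (t + 1) * s₂)) := by
    rw [Fintype.card_sigma, Fintype.card_fin, ← sum_shared ht]
    simp [size]
  let e := Fintype.equivOfCardEq hc
  refine ⟨fun _ i => (e.symm i).1, fun n T => ?_⟩
  have h : (Finset.univ.filter fun i => (e.symm i).1 = T)
      = (Finset.univ : Finset (Fin (size T))).image fun j => e ⟨T, j⟩ := by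
    ext i
    simp only [Finset.mem_filter, Finset.mem_univ, true_and, Finset.mem_image]
    constructor
    · rintro rfl
      exact ⟨(e.symm i).2, by simp⟩
    · rintro ⟨j, rfl⟩
      simp
  rw [subfileSize, h, Finset.card_image_of_injective _ fun j k hjk => by simpa using hjk]
  simp [size]

theorem cornerLoad_le_card {Λ : ℕ} {b : Connectivity Λ} {K : ℕ → ℕ} (hb : ∀ U, b U = K U.card)
    (t : ℕ) : cornerLoad Λ K t ≤ Fintype.card (User b) := by
  have h0 : cornerLoad Λ K 0 = Fintype.card (User b) := by
    have h1 := choose_mul_cornerLoad Λ K 0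
    simp only [Nat.choose_zero_right, Nat.cast_one, one_mul, zero_add] at h1
    rw [h1, Fintype.card_sigma]
    simp only [Fintype.card_fin, hb]
    rw [← Finset.powerset_univ, Finset.sum_powerset_apply_card K]
    simp [mul_comm]
  rw [← h0]
  exact antitone_nat_of_succ_le (isConvexDecreasing_cornerLoad Λ K).succ_le (Nat.zero_le t)

theorem optimalLoad_nonneg {Λ N : ℕ} {b : Connectivity Λ} (hK : Fintype.card (User b) ≤ N)
    (M : ℝ) : 0 ≤ optimalLoad b N M := by
  refine Real.sInf_nonneg ?_
  rintro R ⟨B, hB, P, -, hR⟩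
  obtain ⟨d⟩ : Nonempty (User b ↪ Fin N) :=
    Function.Embedding.nonempty_of_card_le (by simpa using hK)
  obtain ⟨L, hL, -⟩ := hR d
  exact nonneg_of_mul_nonneg_left (L.cast_nonneg.trans hL) (by exact_mod_cast hB)

theorem guaranteesLoad_of_isEmpty {Λ N B : ℕ} {b : Connectivity Λ} [IsEmpty (User b)]
    (P : Placement Λ N B) {R : ℝ} (hR : 0 ≤ R) : GuaranteesLoad b P R := fun _ =>
  ⟨0, by rw [Nat.cast_zero]; positivity, fun _ _ => false, fun u => isEmptyElim u,
    fun _ u => isEmptyElim u⟩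

theorem GuaranteesLoad.mono {Λ N B : ℕ} {b : Connectivity Λ} {P : Placement Λ N B} {R R' : ℝ}
    (h : GuaranteesLoad b P R) (hR : R ≤ R') : GuaranteesLoad b P R' := fun d => by
  obtain ⟨L, hL, hdel⟩ := h d
  exact ⟨L, hL.trans (by gcongr), hdel⟩

/-- The line through two consecutive corner points is a lower bound on the optimal load. Some
achievable load has to be provided, since otherwise the infimum would be `0`. -/
theorem line_le_optimalLoad {Λ N : ℕ} {b : Connectivity Λ} {K : ℕ → ℕ}
    (hb : ∀ U, b U = K U.card) (hN : 0 < N) (hK : Fintype.card (User b) ≤ N) {M R : ℝ}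
    (h : Achievable b N M R) (t : ℕ) :
    cornerLoad Λ K t - (cornerLoad Λ K t - cornerLoad Λ K (t + 1)) * (Λ * M / N - t)
      ≤ optimalLoad b N M :=
  le_csInf ⟨R, h⟩ fun _ hR => line_le_of_achievable hb hN hK hR t

/-- A placement with memory sharing whose total cache memory falls short of the permitted `Λ * M * B`
by at most `δ` library sizes loses at most `N * δ` against the optimal load, because the corner
loads decrease by at most `N` from each `t` to the next. At `t = Λ` every cache holds the whole
library, and additional memory does not help. -/
theorem IsSharedMAN.guaranteesLoad_optimalLoad_add {Λ N B t s₁ s₂ : ℕ} {σ : Splitting Λ N B}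
    (hσ : IsSharedMAN t s₁ s₂ σ) (ht : t ≤ Λ) (hB : 0 < B) (hN : 0 < N) {M δ : ℝ} (hδ : 0 ≤ δ)
    (hmem : MeetsMemory σ.placement M)
    (hM : t = Λ ∨ Λ * M / N - t - Λ.choose (t + 1) * s₂ / B ≤ δ)
    {b : Connectivity Λ} (hb : IsGeneralizedCombinatorial b) (hK : Fintype.card (User b) ≤ N) :
    GuaranteesLoad b σ.placement (optimalLoad b N M + N * δ) := by
  obtain ⟨K, hb⟩ := hb
  have hload := hσ.guaranteesLoad ht hB hN hb
  refine hload.mono ?_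
  have hopt := line_le_optimalLoad hb hN hK ⟨B, hB, σ.placement, hmem, hload⟩ t
  have hf := isConvexDecreasing_cornerLoad Λ K
  have hN' : (0 : ℝ) ≤ N := N.cast_nonneg
  rcases hM with rfl | hM
  · rw [cornerLoad_succ_self, sub_self, zero_mul, sub_zero] at hopt ⊢
    exact hopt.trans (le_add_of_nonneg_right (mul_nonneg hN' hδ))
  · have hslope : cornerLoad Λ K t - cornerLoad Λ K (t + 1) ≤ N := by
      have h1 := cornerLoad_le_card hb t
      have h2 : (Fintype.card (User b) : ℝ) ≤ N := by exact_mod_cast hK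
      linarith [hf.nonneg (t + 1)]
    have h3 := mul_le_mul_of_nonneg_left hM (sub_nonneg.2 (hf.succ_le t))
    have h4 := mul_le_mul_of_nonneg_right hslope hδ
    linarith

/-- The number `μ` of copies of the library that fit into all caches together is approximated from
below by `t + β`, with `β` the fraction of each file that is treated with the parameter `t + 1`; for
`μ ≥ Λ` there is no need to come close. -/
theorem exists_subfile_sizes {Λ : ℕ} {μ δ : ℝ} (hμ : 0 ≤ μ) (hδ : 0 < δ) :
    ∃ t s₁ s₂ : ℕ, t ≤ Λ ∧ 0 < Λ.choose t * s₁ + Λ.choose (t + 1) * s₂ ∧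
      t + (Λ.choose (t + 1) * s₂ / (Λ.choose t * s₁ + Λ.choose (t + 1) * s₂ : ℕ) : ℝ) ≤ μ ∧
      (t = Λ ∨
        μ - t - Λ.choose (t + 1) * s₂ / (Λ.choose t * s₁ + Λ.choose (t + 1) * s₂ : ℕ) ≤ δ) := by
  rcases le_or_gt (Λ : ℝ) μ with h | h
  · exact ⟨Λ, 1, 0, le_rfl, by simp, by simpa using h, Or.inl rfl⟩
  · have htμ := Nat.floor_le hμ
    have hμt := Nat.lt_floor_add_one μ
    have htΛ : ⌊μ⌋₊ < Λ := (Nat.floor_lt hμ).2 h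
    set t := ⌊μ⌋₊
    -- a fraction `p / q` that approximates the fractional part of `μ` from below
    obtain ⟨m, hm⟩ := exists_nat_one_div_lt hδ
    set q := m + 1 with hq
    have hq0 : (0 : ℝ) < q := by positivity
    have hfrac : 0 ≤ (μ - t) * q := mul_nonneg (sub_nonneg.2 htμ) hq0.le
    set p := ⌊(μ - t) * q⌋₊ with hp
    have hp1 : (p : ℝ) ≤ (μ - t) * q := Nat.floor_le hfrac
    have hp2 : (μ - t) * q < p + 1 := Nat.lt_floor_add_one _
    have hpq : p ≤ q := by
      have : (p : ℝ) ≤ q := hp1.trans (by nlinarith)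
      exact_mod_cast this
    have hC1 : 0 < Λ.choose t := Nat.choose_pos htΛ.le
    have hC2 : 0 < Λ.choose (t + 1) := Nat.choose_pos htΛ
    have hsize : Λ.choose t * (Λ.choose (t + 1) * (q - p)) + Λ.choose (t + 1) * (Λ.choose t * p)
        = Λ.choose t * Λ.choose (t + 1) * q := by
      obtain ⟨r, hr⟩ := Nat.exists_eq_add_of_le hpq
      rw [hr, Nat.add_sub_cancel_left]
      ring
    have hC1' : (Λ.choose t : ℝ) ≠ 0 := by exact_mod_cast hC1.ne'
    have hC2' : (Λ.choose (t + 1) : ℝ) ≠ 0 := by exact_mod_cast hC2.ne'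
    have hratio : (Λ.choose (t + 1) * (Λ.choose t * p : ℕ) /
        (Λ.choose t * Λ.choose (t + 1) * q : ℕ) : ℝ) = p / q := by
      push_cast
      field_simp
    refine ⟨t, Λ.choose (t + 1) * (q - p), Λ.choose t * p, htΛ.le, ?_, ?_, Or.inr ?_⟩
    · rw [hsize]
      positivity
    · rw [hsize, hratio]
      have := (div_le_iff₀ hq0).2 hp1
      linarith
    · rw [hsize, hratio]
      have h1 : μ - t < (p + 1) / q := (lt_div_iff₀ hq0).2 hp2
      have h2 : ((p : ℝ) + 1) / q = p / q + 1 / (m + 1) := by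
        rw [add_div, hq]
        push_cast
        rfl
      linarith

end MACC

open MACC in
theorem corollary1 (Λ N : ℕ) :
    -- the basic MAN placement, at the memory sizes `M = t * N / Λ`
    (∀ (t s B : ℕ) (σ : Splitting Λ N B), t ≤ Λ → 0 < B → IsMAN t s σ →
      (∀ ℓ : Fin Λ, ((σ.placement ℓ).card : ℝ) = (t * N / Λ : ℝ) * B) ∧
      ∀ b : Connectivity Λ, IsGeneralizedCombinatorial b → Fintype.card (User b) ≤ N →
        GuaranteesLoad b σ.placement (optimalLoad b N (t * N / Λ))) ∧
    -- with memory sharing between `t` and `t + 1`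
    (∀ (t s₁ s₂ B : ℕ) (σ : Splitting Λ N B) (M : ℝ), t ≤ Λ → 0 < B → IsSharedMAN t s₁ s₂ σ →
      M = (t * (Λ.choose t * s₁ / B) + (t + 1) * (Λ.choose (t + 1) * s₂ / B)) * N / Λ →
      (∀ ℓ : Fin Λ, ((σ.placement ℓ).card : ℝ) = M * B) ∧
      ∀ b : Connectivity Λ, IsGeneralizedCombinatorial b → Fintype.card (User b) ≤ N →
        GuaranteesLoad b σ.placement (optimalLoad b N M)) ∧
    -- at every memory size, up to an arbitrarily small loss that is due to finite file sizes
    (∀ M ε : ℝ, 0 ≤ M → 0 < ε →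
      ∃ (t s₁ s₂ B : ℕ) (σ : Splitting Λ N B), t ≤ Λ ∧ 0 < B ∧ IsSharedMAN t s₁ s₂ σ ∧
        MeetsMemory σ.placement M ∧
        ∀ b : Connectivity Λ, IsGeneralizedCombinatorial b → Fintype.card (User b) ≤ N →
          GuaranteesLoad b σ.placement (optimalLoad b N M + ε)) := by
  have empty_of_card_le : ∀ b : Connectivity Λ, Fintype.card (User b) ≤ 0 → IsEmpty (User b) :=
    fun b hK => Fintype.card_eq_zero_iff.1 (Nat.le_zero.1 hK)
  have shared : ∀ (t s₁ s₂ B : ℕ) (σ : Splitting Λ N B) (M : ℝ), t ≤ Λ → 0 < B →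
      IsSharedMAN t s₁ s₂ σ →
      M = (t * (Λ.choose t * s₁ / B) + (t + 1) * (Λ.choose (t + 1) * s₂ / B)) * N / Λ →
      (∀ ℓ : Fin Λ, ((σ.placement ℓ).card : ℝ) = M * B) ∧
      ∀ b : Connectivity Λ, IsGeneralizedCombinatorial b → Fintype.card (User b) ≤ N →
        GuaranteesLoad b σ.placement (optimalLoad b N M) := by
    intro t s₁ s₂ B σ M ht hB hσ hM
    have hB' : (B : ℝ) ≠ 0 := by exact_mod_cast hB.ne'
    have hcard : ∀ ℓ : Fin Λ, ((σ.placement ℓ).card : ℝ) = M * B := by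
      intro ℓ
      have hΛ : (Λ : ℝ) ≠ 0 := by exact_mod_cast ℓ.pos.ne'
      have h1 : ((σ.placement ℓ).card : ℝ) * Λ
          = N * (t * (Λ.choose t * s₁) + (t + 1) * (Λ.choose (t + 1) * s₂)) := by
        exact_mod_cast hσ.card_placement_mul ht ℓ
      refine mul_right_cancel₀ hΛ ?_
      rw [h1, hM]
      field_simp
    refine ⟨hcard, fun b hb hK => ?_⟩
    rcases Nat.eq_zero_or_pos N with rfl | hN
    · have := empty_of_card_le b hK
      exact guaranteesLoad_of_isEmpty _ (optimalLoad_nonneg hK M)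
    · have hN' : (N : ℝ) ≠ 0 := by exact_mod_cast hN.ne'
      have h := hσ.guaranteesLoad_optimalLoad_add (δ := 0) ht hB hN le_rfl
        (fun ℓ => (hcard ℓ).le) ?_ hb hK
      · simpa using h
      · rcases Nat.eq_zero_or_pos Λ with rfl | hΛ
        · exact Or.inl (Nat.le_zero.1 ht)
        · right
          have hΛ' : (Λ : ℝ) ≠ 0 := by exact_mod_cast hΛ.ne'
          have h2 : (B : ℝ) = Λ.choose t * s₁ + Λ.choose (t + 1) * s₂ := by
            exact_mod_cast hσ.fileSize_eq ht hN
          refine le_of_eq ?_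
          rw [hM]
          field_simp
          rw [h2]
          ring
  refine ⟨fun t s B σ ht hB hσ => ?_, shared, fun M ε hM hε => ?_⟩
  · refine shared t s 0 B σ _ ht hB hσ.isSharedMAN ?_
    rcases Nat.eq_zero_or_pos N with rfl | hN
    · simp
    · have h := hσ.isSharedMAN.fileSize_eq ht hN
      rw [mul_zero, add_zero] at h
      have hB' : (B : ℝ) ≠ 0 := by exact_mod_cast hB.ne'
      have h2 : (Λ.choose t * s : ℝ) = B := by exact_mod_cast h.symm
      rw [h2, div_self hB']
      simp
  · rcases Nat.eq_zero_or_pos N with rfl | hN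
    · obtain ⟨σ, hσ⟩ := exists_isSharedMAN (Nat.zero_le Λ) 0 1 0
      refine ⟨0, 1, 0, _, σ, Nat.zero_le _, by simp, hσ, fun ℓ => ?_, fun b _ hK => ?_⟩
      · rw [Finset.card_eq_zero.2 (Finset.eq_empty_of_isEmpty _), Nat.cast_zero]
        positivity
      · have := empty_of_card_le b hK
        exact guaranteesLoad_of_isEmpty _ (add_nonneg (optimalLoad_nonneg hK M) hε.le)
    · have hN' : (0 : ℝ) < N := by exact_mod_cast hN
      have hμ : 0 ≤ Λ * M / N := by positivity
      have hδ : 0 < ε / N := by positivity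
      obtain ⟨t, s₁, s₂, ht, hB, hle, hM'⟩ := exists_subfile_sizes (Λ := Λ) hμ hδ
      obtain ⟨σ, hσ⟩ := exists_isSharedMAN ht N s₁ s₂
      have hmem : MeetsMemory σ.placement M := by
        intro ℓ
        have hΛ : (0 : ℝ) < Λ := by exact_mod_cast ℓ.pos
        refine le_of_mul_le_mul_right ?_ hΛ
        rw [hσ.card_placement ht hB hN ℓ]
        refine (mul_le_mul_of_nonneg_left hle (by positivity)).trans (le_of_eq ?_)
        field_simp
      refine ⟨t, s₁, s₂, _, σ, ht, hB, hσ, hmem, fun b hb hK => ?_⟩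
      have h := hσ.guaranteesLoad_optimalLoad_add ht hB hN hδ.le hmem hM' hb hK
      rwa [mul_div_cancel₀ _ hN'.ne'] at h
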